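/- Let $H$ be a complex Hilbert space and let $V,W\subset H$ be finite dimensional subspaces such that $V\oplus W^\perp=H$ (so $\dim V=\dim W=:d$). Write $P_V,P_W$ for the orthogonal projections onto $V,W$, and $P_{V//W^\perp}$ for the oblique projection with range $V$ and null space $W^\perp$. For a positive finite rank operator $T$, let $\lambda_1(T)\ge\lambda_2(T)\ge\dots$ be its eigenvalues counted with multiplicity (filled up with zeros), and put $|T|=(T^*T)^{1/2}$ for a bounded operator $T$. The principal angles $0\le\theta_1\le\dots\le\theta_d<\pi/2$ between $V$ and $W$ are given by $\cos\theta_j=\lambda_j(|P_WP_V|)$, and an orthonormal basis $w_1,\dots,w_d$ of $W$ consists of principal vectors if $|P_VP_W|\,w_j=\cos(\theta_j)\,w_j$ for all $j$. For a finite family $\mathcal F=(f_i)_{i=1}^n$ in $H$ let $T_{\mathcal F}:\mathbb C^n\to H$, $T_{\mathcal F}a=\sum_i a_if_i$, be its synthesis operator and $S_{\mathcal F}=T_{\mathcal F}T_{\mathcal F}^*$ its frame operator. If $\mathcal F$ is a frame for $W$, its canonical oblique $V$-dual is $\mathcal F^\#_V=(P_{V//W^\perp}S_{\mathcal F}^\dagger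 f_i)_{i=1}^n$, where $S_{\mathcal F}^\dagger$ is the Moore–Penrose pseudo-inverse. The aliasing of an oblique dual pair $(\mathcal F,\mathcal G)$ (frames for $W$ and $V$ respectively with $T_{\mathcal G}T_{\mathcal F}^*=P_{V//W^\perp}$; for instance $\mathcal G=\mathcal F^\#_V$) is $$A(\mathcal F,\mathcal G)=\sup_{e\in W^\perp\setminus\{0\}}\frac{\|T_{\mathcal G}^*e\|}{\|e\|}$$ (with value $0$ if $W^\perp=\{0\}$). For a unitary $U$ on $H$ put $U\cdot\mathcal F=(Uf_i)_{i=1}^n$. **Theorem 5.4.** Let $\mathcal F=(f_i)_{i=1}^n$ be a frame for $W$, let $\lambda_j=\lambda_j(S_{\mathcal F})$, let $x_1,\dots,x_d$ be an orthonormal basis of $W$ with $S_{\mathcal F}x_j=\lambda_jx_j$ for $j=1,\dots,d$, and let $w_1,\dots,w_d\in W$ be principal vectors between $V$ and $W$. 1. If $U$ is a unitary operator on $H$ with $U(W)=W$, then $$A\big(U\cdot\mathcal F,(U\cdot\mathcal F)^\#_V\big)\ \ge\ \max_{1\le j\le d}\frac{\tan(\theta_j)}{\lambda_{d-j+1}^{1/2}}.$$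 2. If $U_0$ is a unitary operator on $H$ with $U_0x_j=w_{d-j+1}$ for $j=1,\dots,d$, then $$A\big(U_0\cdot\mathcal F,(U_0\cdot\mathcal F)^\#_V\big)\ =\ \max_{1\le j\le d}\frac{\tan(\theta_j)}{\lambda_{d-j+1}^{1/2}}.$$ Such a unitary $U_0$ exists and satisfies $U_0(W)=W$, so the lower bound in 1 is sharp. (If $d=0$, the maximum is read as $0$.) -/

import Mathlib

open scoped InnerProductSpace

noncomputable section

namespace ObliqueDuality

variable {H : Type*} [NormedAddCommGroup H] [InnerProductSpace ℂ H]
variable {ι : Type*} [Fintype ι]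

/-- A finite family `F` of vectors is a frame for the subspace `W`: its members lie in `W` and
`A ‖f‖² ≤ ∑ i, |⟨f, F i⟩|² ≤ B ‖f‖²` on `W` for some constants `0 < A < B`. -/
def IsFrameFor (F : ι → H) (W : Submodule ℂ H) : Prop :=
  (∀ i, F i ∈ W) ∧ ∃ A B : ℝ, 0 < A ∧ A < B ∧ ∀ f ∈ W,
    A * ‖f‖ ^ 2 ≤ ∑ i, ‖⟪F i, f⟫_ℂ‖ ^ 2 ∧ ∑ i, ‖⟪F i, f⟫_ℂ‖ ^ 2 ≤ B * ‖f‖ ^ 2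

/-- The synthesis operator `T_F : ℓ²(ι) → H`, `a ↦ ∑ i, a i • F i`. -/
def synthesis (F : ι → H) : EuclideanSpace ℂ ι →L[ℂ] H :=
  ∑ i, (EuclideanSpace.proj i : EuclideanSpace ℂ ι →L[ℂ] ℂ).smulRight (F i)

/-- The number of eigenvalues of `T` that are real and at least `μ`, counted with multiplicity
(meant for `μ > 0` and `T` positive of finite rank). -/
def eigenvalueCount (T : H →L[ℂ] H) (μ : ℝ) : ℕ :=
  Module.finrank ℂ
    (⨆ ν : {ν : ℝ // μ ≤ ν}, Module.End.eigenspace (T : H →ₗ[ℂ] H) ((ν : ℝ) : ℂ) :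
      Submodule ℂ H)

/-- The list `λ(T)` of eigenvalues of a positive finite rank operator `T`, counted with
multiplicity, arranged in non-increasing order, starting with index `0`, and filled up with zeros:
`λ_j(T)` is the largest `μ > 0` such that at least `j + 1` eigenvalues of `T` are `≥ μ`, and it is
`0` if there is no such `μ`. -/
def eigenvalueList (T : H →L[ℂ] H) (j : ℕ) : ℝ :=
  sSup {μ : ℝ | 0 < μ ∧ j < eigenvalueCount T μ}

variable [CompleteSpace H]

/-- The analysis operator `T_F^* : H → ℓ²(ι)`, `f ↦ (⟨f, F i⟩)_i`. -/
def analysis (F : ι → H) : H →L[ℂ] EuclideanSpace ℂ ι :=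
  ContinuousLinearMap.adjoint (synthesis F)

/-- The frame operator `S_F = T_F T_F^*`. -/
def frameOperator (F : ι → H) : H →L[ℂ] H :=
  synthesis F ∘L analysis F

/-- `B` satisfies the four Penrose equations with respect to `A`. -/
structure IsMoorePenrose (A B : H →L[ℂ] H) : Prop where
  mul_mul_left : A * B * A = A
  mul_mul_right : B * A * B = B
  isSelfAdjoint_left : IsSelfAdjoint (A * B)
  isSelfAdjoint_right : IsSelfAdjoint (B * A)

open Classical in
/-- The Moore-Penrose pseudo-inverse `A†` of an operator with closed range (with the value `0` for
operators that have no pseudo-inverse). -/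
def pseudoInverse (A : H →L[ℂ] H) : H →L[ℂ] H :=
  if h : ∃ B, IsMoorePenrose A B then h.choose else 0

/-- The canonical `V`-dual of a frame `F` for `W`, whose members are the vectors
`P_{V//Wᗮ} S_F† (F i)`, where `P_{V//Wᗮ}` is the oblique projection with range `V` and null
space `Wᗮ`. -/
def canonicalDual {V W : Submodule ℂ H} (hVW : IsCompl V Wᗮ) (F : ι → H) : ι → H :=
  fun i => Submodule.projection V Wᗮ hVW (pseudoInverse (frameOperator F) (F i))

/-- The aliasing `A(F, G) = sup {‖T_G^* e‖ / ‖e‖ : e ∈ Wᗮ, e ≠ 0}` of an oblique dual pair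
`(F, G)`, where `F` is a frame for `W`; it depends on `F` only through the subspace `W` that `F`
spans. The supremum over the empty set (the case `Wᗮ = 0`) is `0`. -/
def aliasing (W : Submodule ℂ H) (G : ι → H) : ℝ :=
  ⨆ e : {e : H // e ∈ Wᗮ ∧ e ≠ 0}, ‖analysis G (e : H)‖ / ‖(e : H)‖

section Angles

variable (V W : Submodule ℂ H) [V.HasOrthogonalProjection] [W.HasOrthogonalProjection]

/-- The principal angles `θ_0 ≤ θ_1 ≤ …` in `[0, π/2]` between two subspaces `V`, `W` of the same
finite dimension `d`: the numbers `cos θ_j`, `j < d`, are the first `d` entries of the eigenvalue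
list of `|P_W P_V|`. -/
def principalAngle (j : ℕ) : ℝ :=
  Real.arccos (eigenvalueList (CFC.abs (W.starProjection * V.starProjection)) j)

/-- An orthonormal basis `w` of `W` consists of principal vectors between `V` and `W`:
`|P_V P_W| w_j = cos θ_j • w_j` for all `j`. -/
def IsPrincipal {d : ℕ} (w : OrthonormalBasis (Fin d) ℂ W) : Prop :=
  ∀ j : Fin d, CFC.abs (V.starProjection * W.starProjection) (w j : H) =
    ((Real.cos (principalAngle V W j) : ℝ) : ℂ) • (w j : H)

end Angles

end ObliqueDuality

end

/-! Write `Q` for the oblique projection and `T*` for the analysis operator of a frame for `W`. By a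
duality argument (Cauchy–Schwarz in both directions), the aliasing of the canonical dual is the
least `M ≥ 0` with `‖Q z - z‖ ≤ M ‖T* z‖` for all `z ∈ W`: `norm_projection_sub_le_aliasing` and
`aliasing_canonicalDual_le`.

Both sides are diagonal on `W`: `‖Q z - z‖² = ∑ tan² θ_i |⟨w_i, z⟩|²` and `‖T* z‖² = ∑ λ_i |⟨x_i,
z⟩|²`. A unitary preserving `W` only replaces `x` by another orthonormal basis of `W`, with the same
`λ_i`.

The lower bound is then a Courant–Fischer argument. The dimension count
`exists_ne_zero_inner_eq_zero` gives a nonzero `z ∈ W` on which the first form is at least `tan² θ_j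
‖z‖²` and the second at most `λ_{rev j} ‖z‖²`. When `x` is aligned with the reversed `w`, both forms
are diagonal in one basis and a termwise comparison gives equality. -/

namespace ObliqueDuality

noncomputable section

section

/-! ### Eigenvalue lists -/

section EigenvalueList

variable {H : Type*} [NormedAddCommGroup H] [InnerProductSpace ℂ H]

theorem eigenvalueList_nonneg (T : H →L[ℂ] H) (j : ℕ) : 0 ≤ eigenvalueList T j :=
  Real.sSup_nonneg fun _ h => h.1.le

theorem eigenvalueCount_eq_zero {T : H →L[ℂ] H} {μ : ℝ} (hμ : ‖T‖ < μ) :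
    eigenvalueCount T μ = 0 := by
  have hbot : (⨆ ν : {ν : ℝ // μ ≤ ν},
      Module.End.eigenspace (T : H →ₗ[ℂ] H) ((ν : ℝ) : ℂ)) = ⊥ := by
    rw [iSup_eq_bot]
    rintro ⟨ν, hν⟩
    rw [Submodule.eq_bot_iff]
    intro f hf
    rw [Module.End.mem_eigenspace_iff] at hf
    have h1 : T f = (ν : ℂ) • f := hf
    have h2 := T.le_opNorm f
    have hν0 : 0 ≤ ν := (norm_nonneg T).trans (hμ.le.trans hν)
    rw [h1, norm_smul, Complex.norm_real, Real.norm_of_nonneg hν0] at h2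
    by_contra hne
    have := le_of_mul_le_mul_right h2 (norm_pos_iff.mpr hne)
    linarith
  rw [eigenvalueCount, hbot, finrank_bot]

theorem eigenvalueList_antitone (T : H →L[ℂ] H) : Antitone (eigenvalueList T) := by
  intro i j hij
  by_cases hne : {μ : ℝ | 0 < μ ∧ j < eigenvalueCount T μ}.Nonempty
  -- No eigenvalue exceeds `‖T‖`, so the supremum is not a default value.
  · refine csSup_le_csSup ⟨‖T‖, ?_⟩ hne fun μ h => ⟨h.1, hij.trans_lt h.2⟩
    rintro μ ⟨-, h⟩
    by_contra hμ
    simp [eigenvalueCount_eq_zero (not_le.mp hμ)] at h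
  · rw [Set.not_nonempty_iff_eq_empty] at hne
    rw [eigenvalueList, hne, Real.sSup_empty]
    exact eigenvalueList_nonneg T i

end EigenvalueList

/-! ### Frames, frame operators and their pseudo-inverses -/

section FramesBasic

variable {H : Type*} [NormedAddCommGroup H] [InnerProductSpace ℂ H]
variable {ι : Type*} [Fintype ι]

theorem synthesis_apply (F : ι → H) (a : EuclideanSpace ℂ ι) :
    synthesis F a = ∑ i, a i • F i := by
  simp [synthesis]

/-- A frame for `W` is moved by a unitary that preserves `W` to a frame for `W`. -/
theorem IsFrameFor.map {W : Submodule ℂ H} {F : ι → H} (hF : IsFrameFor F W)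
    (U : H ≃ₗᵢ[ℂ] H) (hU : W.map (U : H →ₗ[ℂ] H) = W) :
    IsFrameFor (fun i => U (F i)) W := by
  obtain ⟨hm, A, B, hA, hAB, h⟩ := hF
  refine ⟨fun i => ?_, A, B, hA, hAB, fun f hf => ?_⟩
  · rw [← hU]
    exact Submodule.mem_map_of_mem (hm i)
  · rw [← hU] at hf
    obtain ⟨g, hg, rfl⟩ := hf
    simpa using h g hg

end FramesBasic

variable {H : Type*} [NormedAddCommGroup H] [InnerProductSpace ℂ H] [CompleteSpace H]

section Frames

variable {ι : Type*} [Fintype ι]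

theorem analysis_apply (F : ι → H) (f : H) (i : ι) : analysis F f i = ⟪F i, f⟫_ℂ := by
  classical
  have h : ⟪EuclideanSpace.single i (1 : ℂ), analysis F f⟫_ℂ = ⟪F i, f⟫_ℂ := by
    rw [analysis, ContinuousLinearMap.adjoint_inner_right, synthesis_apply]
    simp [PiLp.single_apply]
  simpa [EuclideanSpace.inner_single_left] using h

theorem norm_analysis_sq (F : ι → H) (f : H) :
    ‖analysis F f‖ ^ 2 = ∑ i, ‖⟪F i, f⟫_ℂ‖ ^ 2 := by
  simp [EuclideanSpace.norm_sq_eq, analysis_apply]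

theorem inner_analysis_analysis (F : ι → H) (f g : H) :
    ⟪analysis F f, analysis F g⟫_ℂ = ⟪frameOperator F f, g⟫_ℂ := by
  simp [frameOperator, analysis, ContinuousLinearMap.adjoint_inner_right]

theorem inner_frameOperator_comm (F : ι → H) (f g : H) :
    ⟪frameOperator F f, g⟫_ℂ = ⟪f, frameOperator F g⟫_ℂ := by
  rw [← inner_analysis_analysis, frameOperator]
  simp [analysis, ContinuousLinearMap.adjoint_inner_left]

theorem frameOperator_isSelfAdjoint (F : ι → H) : IsSelfAdjoint (frameOperator F) := by
  rw [ContinuousLinearMap.isSelfAdjoint_iff_isSymmetric]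
  exact fun f g => inner_frameOperator_comm F f g

namespace IsFrameFor

variable {W : Submodule ℂ H} {F : ι → H}

theorem frameOperator_mem (hF : IsFrameFor F W) (f : H) : frameOperator F f ∈ W := by
  rw [frameOperator, ContinuousLinearMap.comp_apply, synthesis_apply]
  exact W.sum_mem fun i _ => W.smul_mem _ (hF.1 i)

theorem frameOperator_eq_zero (hF : IsFrameFor F W) {f : H} (hf : f ∈ Wᗮ) :
    frameOperator F f = 0 := by
  have h : analysis F f = 0 := by
    ext i
    rw [analysis_apply]
    exact hf _ (hF.1 i)
  rw [frameOperator, ContinuousLinearMap.comp_apply, h, map_zero]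

theorem norm_analysis_pos (hF : IsFrameFor F W) {f : H} (hf : f ∈ W) (h0 : f ≠ 0) :
    0 < ‖analysis F f‖ := by
  obtain ⟨-, A, B, hA, -, h⟩ := hF
  have h1 := (h f hf).1
  rw [← norm_analysis_sq] at h1
  have : 0 < ‖f‖ := norm_pos_iff.mpr h0
  have h2 : 0 < ‖analysis F f‖ ^ 2 := lt_of_lt_of_le (by positivity) h1
  exact (norm_nonneg _).lt_of_ne fun h3 => by simp [← h3] at h2

theorem frameOperator_injOn (hF : IsFrameFor F W) {f : H} (hf : f ∈ W)
    (h : frameOperator F f = 0) : f = 0 := by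
  by_contra h0
  have h1 := hF.norm_analysis_pos hf h0
  have h2 := inner_analysis_analysis F f f
  rw [h, inner_zero_left, inner_self_eq_zero] at h2
  simp [h2] at h1

/-- The frame operator restricts to an injective, hence bijective, endomorphism of `W`. Its inverse
composed with the projection onto `W` works, since both products equal that projection. This rules
out the default value of `pseudoInverse`. -/
theorem exists_isMoorePenrose [FiniteDimensional ℂ W] (hF : IsFrameFor F W) :
    ∃ B, IsMoorePenrose (frameOperator F) B := by
  set S := frameOperator F with hS
  let SW : W →ₗ[ℂ] W := ((S : H →ₗ[ℂ] H).comp W.subtype).codRestrict W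
    fun f => hF.frameOperator_mem f
  have hinj : Function.Injective SW := by
    rw [← LinearMap.ker_eq_bot, LinearMap.ker_eq_bot']
    intro f hf
    exact Subtype.ext (hF.frameOperator_injOn f.2 (congrArg Subtype.val hf))
  let E : W ≃ₗ[ℂ] W := LinearEquiv.ofInjectiveEndo SW hinj
  have hE : ∀ f : W, ((E f : W) : H) = S f := fun f => rfl
  let B : H →L[ℂ] H :=
    W.subtypeL ∘L (LinearMap.toContinuousLinearMap (E.symm : W →ₗ[ℂ] W)) ∘L
      W.orthogonalProjectionOnto
  have hB : ∀ f : H, B f = (E.symm (W.orthogonalProjectionOnto f) : H) := fun f => rfl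
  have hSB : S * B = W.starProjection := by
    ext f
    rw [mul_apply_eq_comp, hB, ← hE, LinearEquiv.apply_symm_apply]
    rfl
  have hSP : ∀ f, S (W.starProjection f) = S f := by
    intro f
    have := hF.frameOperator_eq_zero (W.sub_starProjection_mem_orthogonal f)
    rw [map_sub, sub_eq_zero] at this
    exact this.symm
  have hBS : B * S = W.starProjection := by
    ext f
    rw [mul_apply_eq_comp, ← hSP, hB]
    have : W.orthogonalProjectionOnto (S (W.starProjection f)) =
        E (W.orthogonalProjectionOnto f) := by
      rw [← W.orthogonalProjectionOnto_mem_subspace_eq_self (E _), hE]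
      rfl
    rw [this, LinearEquiv.symm_apply_apply]
    rfl
  refine ⟨B, ?_, ?_, ?_, ?_⟩
  · rw [hSB]
    ext f
    exact Submodule.starProjection_eq_self_iff.mpr (hF.frameOperator_mem f)
  · rw [hBS]
    ext f
    exact Submodule.starProjection_eq_self_iff.mpr (E.symm (W.orthogonalProjectionOnto f)).2
  · rw [hSB]
    exact isSelfAdjoint_starProjection W
  · rw [hBS]
    exact isSelfAdjoint_starProjection W

theorem pseudoInverse_spec [FiniteDimensional ℂ W] (hF : IsFrameFor F W) :
    IsMoorePenrose (frameOperator F) (pseudoInverse (frameOperator F)) := by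
  have h := hF.exists_isMoorePenrose
  rw [pseudoInverse, dif_pos h]
  exact h.choose_spec

/-- The adjoint of the pseudo-inverse of the frame operator maps into `W`. -/
theorem adjoint_pseudoInverse_mem [FiniteDimensional ℂ W] (hF : IsFrameFor F W) (f : H) :
    star (pseudoInverse (frameOperator F)) f ∈ W := by
  have h := hF.pseudoInverse_spec
  set S := frameOperator F with hS
  set B := pseudoInverse S
  have h1 : star B = S * (B * star B) := by
    conv_lhs => rw [← h.mul_mul_right, mul_assoc, star_mul, h.isSelfAdjoint_left.star_eq, mul_assoc]
  rw [h1]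
  exact hF.frameOperator_mem _

/-- The adjoint of the pseudo-inverse of the frame operator inverts it on `W`. -/
theorem frameOperator_adjoint_pseudoInverse [FiniteDimensional ℂ W] (hF : IsFrameFor F W)
    {f : H} (hf : f ∈ W) :
    frameOperator F (star (pseudoInverse (frameOperator F)) f) = f := by
  have h := hF.pseudoInverse_spec
  have hsa := frameOperator_isSelfAdjoint F
  have hmem : ∀ g, frameOperator F g ∈ W := hF.frameOperator_mem
  set S := frameOperator F with hS
  set B := pseudoInverse S
  have h1 : S * star B = B * S := by
    conv_lhs => rw [← hsa.star_eq, ← star_mul]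
    exact h.isSelfAdjoint_right.star_eq
  have h2 : S (star B f) = B (S f) := by
    simpa using congrArg (fun T : H →L[ℂ] H => T f) h1
  have hW : S (star B f) - f ∈ W := W.sub_mem (hmem _) hf
  -- `S B* f = B S f`, and `S B S = S`; injectivity of `S` on `W` finishes.
  have h3 : S (S (star B f) - f) = 0 := by
    rw [map_sub, h2, sub_eq_zero]
    simpa using congrArg (fun T : H →L[ℂ] H => T f) h.mul_mul_left
  exact sub_eq_zero.mp (hF.frameOperator_injOn hW h3)

end IsFrameFor

end Frames

end

section

/-! ### The oblique projection -/

section ObliqueProjection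

variable {H : Type*} [NormedAddCommGroup H] [InnerProductSpace ℂ H]
variable {V W : Submodule ℂ H} (hVW : IsCompl V Wᗮ)

theorem projection_sub_self_mem (f : H) : Submodule.projection V Wᗮ hVW f - f ∈ Wᗮ := by
  rw [← Submodule.projection_apply_eq_zero_iff hVW, map_sub, sub_eq_zero]
  exact Submodule.projection_apply_of_mem_left hVW (Submodule.projection_apply_mem hVW f)

theorem projection_eq_of_sub_mem {v f : H} (hv : v ∈ V) (h : v - f ∈ Wᗮ) :
    Submodule.projection V Wᗮ hVW f = v := by
  rw [← Submodule.projection_apply_eq_zero_iff hVW, map_sub, sub_eq_zero,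
    Submodule.projection_apply_of_mem_left hVW hv] at h
  exact h.symm

/-- If `f ∈ W` were orthogonal to `V`, it would be orthogonal to `V + Wᗮ = H`, hence to itself. -/
theorem starProjection_ne_zero [FiniteDimensional ℂ V] (hVW : IsCompl V Wᗮ) {f : H}
    (hf : f ∈ W) (h0 : f ≠ 0) : V.starProjection f ≠ 0 := by
  intro h
  rw [Submodule.starProjection_apply_eq_zero_iff] at h
  apply h0
  have h1 : ⟪f, f⟫_ℂ = 0 := by
    have h2 : ⟪f, f⟫_ℂ = ⟪Submodule.projection V Wᗮ hVW f -
        (Submodule.projection V Wᗮ hVW f - f), f⟫_ℂ := by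
      rw [sub_sub_cancel]
    rw [h2, inner_sub_left, Submodule.inner_right_of_mem_orthogonal
      (Submodule.projection_apply_mem hVW f) h, Submodule.inner_left_of_mem_orthogonal hf
      (projection_sub_self_mem hVW f), sub_zero]
  simpa using h1

variable [FiniteDimensional ℂ W]

/-- The oblique projection along `Wᗮ` as a continuous linear map, for finite dimensional `W`. -/
def obliqueProjection : H →L[ℂ] H :=
  LinearMap.toContinuousLinearMap ((Submodule.projection V Wᗮ hVW).comp W.subtype) ∘L
    W.orthogonalProjectionOnto

theorem obliqueProjection_apply (f : H) :
    obliqueProjection hVW f = Submodule.projection V Wᗮ hVW f := by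
  have h := (Submodule.projection_apply_eq_zero_iff hVW).mpr (W.sub_starProjection_mem_orthogonal f)
  rw [map_sub, sub_eq_zero] at h
  exact h.symm

end ObliqueProjection

/-! ### Diagonal quadratic forms on `W` -/

section Bases

variable {H : Type*} [NormedAddCommGroup H] [InnerProductSpace ℂ H] {W : Submodule ℂ H}
variable {κ : Type*} [Fintype κ]

/-- Pythagoras for the orthogonal images of a basis; it diagonalizes both `Q - 1` and the analysis
operator. -/
theorem norm_sq_eq_sum_of_inner {H' : Type*} [NormedAddCommGroup H'] [InnerProductSpace ℂ H']
    [DecidableEq κ] (b : OrthonormalBasis κ ℂ W) (L : H →ₗ[ℂ] H') (t : κ → ℝ)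
    (h : ∀ i j, ⟪L (b i), L (b j)⟫_ℂ = if i = j then (t i : ℂ) else 0) {z : H} (hz : z ∈ W) :
    ‖L z‖ ^ 2 = ∑ i, t i * ‖⟪(b i : H), z⟫_ℂ‖ ^ 2 := by
  have hexp : L z = ∑ i, ⟪(b i : H), z⟫_ℂ • L (b i) := by
    have h1 := congrArg (fun w : W => L w) (b.sum_repr' ⟨z, hz⟩)
    simpa using h1.symm
  have h2 := inner_self_eq_norm_sq_to_K (𝕜 := ℂ) (L z)
  have h3 : ⟪L z, L z⟫_ℂ = ∑ i, ((t i * ‖⟪(b i : H), z⟫_ℂ‖ ^ 2 : ℝ) : ℂ) := by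
    rw [hexp, sum_inner]
    refine Finset.sum_congr rfl fun i _ => ?_
    rw [inner_sum, Finset.sum_eq_single i]
    · rw [inner_smul_left, inner_smul_right, h, if_pos rfl]
      push_cast
      rw [← Complex.conj_mul']
      ring
    · intro j _ hj
      rw [inner_smul_left, inner_smul_right, h, if_neg hj.symm]
      simp
    · simp
  have h4 : ((‖L z‖ ^ 2 : ℝ) : ℂ) = ((∑ i, t i * ‖⟪(b i : H), z⟫_ℂ‖ ^ 2 : ℝ) : ℂ) := by
    rw [Complex.ofReal_sum, ← h3, h2, Complex.ofReal_pow]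
    rfl
  exact Complex.ofReal_injective h4

theorem sum_sq_norm_inner_coe (b : OrthonormalBasis κ ℂ W) {z : H}
    (hz : z ∈ W) : ∑ i, ‖⟪(b i : H), z⟫_ℂ‖ ^ 2 = ‖z‖ ^ 2 := by
  simpa using b.sum_sq_norm_inner_right ⟨z, hz⟩

/-- A dimension count: two orthonormal bases of `W` and `j < d` leave a nonzero vector of `W` that
is orthogonal to the first `j` vectors of the one and the first `d - 1 - j` of the other. -/
theorem exists_ne_zero_inner_eq_zero {d : ℕ} (b x : OrthonormalBasis (Fin d) ℂ W) (j : Fin d) :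
    ∃ z ∈ W, z ≠ 0 ∧ (∀ i < j, ⟪(b i : H), z⟫_ℂ = 0) ∧
      ∀ k < Fin.rev j, ⟪(x k : H), z⟫_ℂ = 0 := by
  have : FiniteDimensional ℂ W := b.toBasis.finiteDimensional_of_finite
  let f : W →ₗ[ℂ] ({i // i < j} → ℂ) × ({k // k < Fin.rev j} → ℂ) :=
    (LinearMap.pi fun i => (innerSL ℂ (b i.1) : W →ₗ[ℂ] ℂ)).prod
      (LinearMap.pi fun k => (innerSL ℂ (x k.1) : W →ₗ[ℂ] ℂ))
  have hf : LinearMap.ker f ≠ ⊥ := by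
    apply LinearMap.ker_ne_bot_of_finrank_lt
    have hd : Module.finrank ℂ W = d := by simpa using Module.finrank_eq_card_basis b.toBasis
    have hcard : ∀ m : Fin d, Fintype.card {i // i < m} = m := by
      intro m
      rw [Fintype.card_subtype, Finset.filter_gt_eq_Iio, Fin.card_Iio]
    rw [Module.finrank_prod, Module.finrank_fintype_fun_eq_card,
      Module.finrank_fintype_fun_eq_card, hcard, hcard, hd, Fin.val_rev]
    omega
  obtain ⟨z, hz, h0⟩ := Submodule.exists_mem_ne_zero_of_ne_bot hf
  have hz' : f z = 0 := hz
  refine ⟨z, z.2, fun h => h0 (Subtype.ext h), fun i hi => ?_, fun k hk => ?_⟩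
  · exact congrFun (congrArg Prod.fst hz') ⟨i, hi⟩
  · exact congrFun (congrArg Prod.snd hz') ⟨k, hk⟩

variable {V : Submodule ℂ H} [FiniteDimensional ℂ V] [FiniteDimensional ℂ W]
  (hVW : IsCompl V Wᗮ)

/-- The map `P_{V//Wᗮ} - 1` is diagonal in a basis of `W` that diagonalizes `P_W P_V P_W`. -/
theorem norm_projection_sub_sq (b : OrthonormalBasis κ ℂ W) {c : κ → ℝ} (hc : ∀ i, c i ≠ 0)
    (h : ∀ i, W.starProjection (V.starProjection (b i)) = ((c i ^ 2 : ℝ) : ℂ) • (b i : H))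
    {z : H} (hz : z ∈ W) :
    ‖Submodule.projection V Wᗮ hVW z - z‖ ^ 2 =
      ∑ i, (1 / c i ^ 2 - 1) * ‖⟪(b i : H), z⟫_ℂ‖ ^ 2 := by
  classical
  have hcc : ∀ i, (c i : ℂ) ≠ 0 := fun i => by exact_mod_cast hc i
  -- Since `P_W P_V b_i = c_i² b_i`, the vector `c_i⁻² P_V b_i` of `V` differs from `b_i` by an
  -- element of `Wᗮ`.
  have hQ : ∀ i, Submodule.projection V Wᗮ hVW (b i) =
      ((c i : ℂ) ^ 2)⁻¹ • V.starProjection (b i) := by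
    intro i
    refine projection_eq_of_sub_mem hVW (V.smul_mem _ (V.starProjection_apply_mem _)) ?_
    have h1 := Wᗮ.smul_mem ((c i : ℂ) ^ 2)⁻¹
      (W.sub_starProjection_mem_orthogonal (V.starProjection (b i)))
    rw [h, smul_sub, smul_smul] at h1
    push_cast at h1
    rwa [inv_mul_cancel₀ (pow_ne_zero 2 (hcc i)), one_smul] at h1
  refine norm_sq_eq_sum_of_inner b (Submodule.projection V Wᗮ hVW - LinearMap.id) _
    (fun i j => ?_) hz
  have hb := orthonormal_iff_ite.mp b.orthonormal i j
  rw [Submodule.coe_inner] at hb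
  simp only [LinearMap.sub_apply, LinearMap.id_apply]
  -- As `Q - 1` has values in `Wᗮ`, the Gram matrix is `⟨Q b_i, Q b_j⟩ - ⟨b_i, b_j⟩`, with diagonal
  -- `c_i⁻⁴ c_i² - 1`.
  rw [inner_sub_right, Submodule.inner_left_of_mem_orthogonal (b j).2
    (projection_sub_self_mem hVW _), sub_zero, inner_sub_left]
  have h1 : ⟪(b i : H), Submodule.projection V Wᗮ hVW (b j)⟫_ℂ = ⟪(b i : H), (b j : H)⟫_ℂ := by
    rw [← sub_eq_zero, ← inner_sub_right]
    exact Submodule.inner_right_of_mem_orthogonal (b i).2 (projection_sub_self_mem hVW _)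
  have h2 : ⟪V.starProjection (b i), V.starProjection (b j)⟫_ℂ =
      ((c i ^ 2 : ℝ) : ℂ) * ⟪(b i : H), (b j : H)⟫_ℂ := by
    rw [Submodule.inner_starProjection_left_eq_right,
      Submodule.starProjection_eq_self_iff.mpr (V.starProjection_apply_mem _),
      ← Submodule.inner_starProjection_left_eq_right]
    have h3 : ⟪W.starProjection (V.starProjection (b i)), (b j : H)⟫_ℂ =
        ⟪V.starProjection (b i), (b j : H)⟫_ℂ := by
      rw [Submodule.inner_starProjection_left_eq_right,
        Submodule.starProjection_eq_self_iff.mpr (b j).2]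
    rw [← h3, h, inner_smul_left, Complex.conj_ofReal]
  rw [h1, hQ, hQ, inner_smul_left, inner_smul_right, h2, hb]
  split_ifs with hij
  · subst hij
    have := hcc i
    push_cast
    simp only [map_inv₀, map_pow, Complex.conj_ofReal]
    field_simp
  · simp

end Bases

variable {H : Type*} [NormedAddCommGroup H] [InnerProductSpace ℂ H] [CompleteSpace H]

/-! ### Aliasing as the best constant in an inequality on `W` -/

section Aliasing

variable {ι : Type*} [Fintype ι]

theorem aliasing_nonneg (W : Submodule ℂ H) (G : ι → H) : 0 ≤ aliasing W G :=
  Real.iSup_nonneg fun _ => by positivity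

theorem norm_analysis_le_aliasing (W : Submodule ℂ H) (G : ι → H) {e : H} (he : e ∈ Wᗮ) :
    ‖analysis G e‖ ≤ aliasing W G * ‖e‖ := by
  rcases eq_or_ne e 0 with rfl | h0
  · simp
  · have hb : BddAbove (Set.range fun e : {e : H // e ∈ Wᗮ ∧ e ≠ 0} =>
        ‖analysis G (e : H)‖ / ‖(e : H)‖) := by
      refine ⟨‖analysis G‖, ?_⟩
      rintro _ ⟨e, rfl⟩
      exact (analysis G).ratio_le_opNorm e
    have := le_ciSup hb ⟨e, he, h0⟩
    exact (div_le_iff₀ (norm_pos_iff.mpr h0)).mp this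

theorem aliasing_le {W : Submodule ℂ H} {G : ι → H} {M : ℝ} (hM : 0 ≤ M)
    (h : ∀ e ∈ Wᗮ, ‖analysis G e‖ ≤ M * ‖e‖) : aliasing W G ≤ M :=
  Real.iSup_le (fun e => div_le_of_le_mul₀ (norm_nonneg _) hM (h e e.2.1)) hM

variable {V W : Submodule ℂ H} [FiniteDimensional ℂ W] (hVW : IsCompl V Wᗮ)

theorem adjoint_obliqueProjection_mem (e : H) : star (obliqueProjection hVW) e ∈ W := by
  suffices h : star (obliqueProjection hVW) e ∈ Wᗮᗮ by rwa [W.orthogonal_orthogonal] at h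
  intro u hu
  rw [ContinuousLinearMap.star_eq_adjoint, ContinuousLinearMap.adjoint_inner_right,
    obliqueProjection_apply, (Submodule.projection_apply_eq_zero_iff hVW).mpr hu, inner_zero_left]

theorem analysis_canonicalDual (F : ι → H) (e : H) :
    analysis (canonicalDual hVW F) e = analysis F
      (star (pseudoInverse (frameOperator F)) (star (obliqueProjection hVW) e)) := by
  ext i
  rw [analysis_apply, analysis_apply, canonicalDual, ← obliqueProjection_apply,
    ContinuousLinearMap.star_eq_adjoint, ContinuousLinearMap.star_eq_adjoint,
    ContinuousLinearMap.adjoint_inner_right, ContinuousLinearMap.adjoint_inner_right]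

/-- The analysis operator of the canonical dual is given by a lift `y ∈ W`, through which
`P_{V//Wᗮ}` pairs with the frame. -/
theorem exists_analysis_canonicalDual {F : ι → H} (hF : IsFrameFor F W) {e : H} (he : e ∈ Wᗮ) :
    ∃ y ∈ W, analysis (canonicalDual hVW F) e = analysis F y ∧
      ∀ z ∈ W, ⟪analysis F y, analysis F z⟫_ℂ =
        ⟪e, Submodule.projection V Wᗮ hVW z - z⟫_ℂ := by
  refine ⟨_, hF.adjoint_pseudoInverse_mem _, analysis_canonicalDual hVW F e, fun z hz => ?_⟩
  rw [inner_analysis_analysis,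
    hF.frameOperator_adjoint_pseudoInverse (adjoint_obliqueProjection_mem hVW e),
    ContinuousLinearMap.star_eq_adjoint, ContinuousLinearMap.adjoint_inner_left,
    obliqueProjection_apply, inner_sub_right, Submodule.inner_left_of_mem_orthogonal hz he,
    sub_zero]

/-- Test the aliasing on `e = Q z - z` itself: with the lift `y` of `e`, `‖e‖² = ⟨T* y, T* z⟩ ≤ A
‖e‖ ‖T* z‖`. -/
theorem norm_projection_sub_le_aliasing {F : ι → H} (hF : IsFrameFor F W) {z : H} (hz : z ∈ W) :
    ‖Submodule.projection V Wᗮ hVW z - z‖ ≤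
      aliasing W (canonicalDual hVW F) * ‖analysis F z‖ := by
  set e := Submodule.projection V Wᗮ hVW z - z with he
  have heW : e ∈ Wᗮ := projection_sub_self_mem hVW z
  obtain ⟨y, -, hy, h⟩ := exists_analysis_canonicalDual hVW hF heW
  have h1 := h z hz
  rw [← he, inner_self_eq_norm_sq_to_K] at h1
  have h2 := norm_inner_le_norm (𝕜 := ℂ) (analysis F y) (analysis F z)
  rw [h1] at h2
  simp only [Complex.coe_algebraMap, norm_pow, Complex.norm_real, norm_norm] at h2
  have h3 := norm_analysis_le_aliasing W (canonicalDual hVW F) heW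
  rw [hy] at h3
  rcases (norm_nonneg e).eq_or_lt with h0 | h0
  · rw [← h0]
    exact mul_nonneg (aliasing_nonneg _ _) (norm_nonneg _)
  · have h4 : ‖e‖ * ‖e‖ ≤ (aliasing W (canonicalDual hVW F) * ‖analysis F z‖) * ‖e‖ := by
      nlinarith [mul_le_mul_of_nonneg_right h3 (norm_nonneg (analysis F z))]
    exact le_of_mul_le_mul_right h4 h0

/-- Pair the lift `y` with itself: `‖T* y‖² = ⟨e, Q y - y⟩ ≤ ‖e‖ M ‖T* y‖`. -/
theorem aliasing_canonicalDual_le {F : ι → H} (hF : IsFrameFor F W) {M : ℝ} (hM : 0 ≤ M)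
    (h : ∀ y ∈ W, ‖Submodule.projection V Wᗮ hVW y - y‖ ≤ M * ‖analysis F y‖) :
    aliasing W (canonicalDual hVW F) ≤ M := by
  refine aliasing_le hM fun e he => ?_
  obtain ⟨y, hyW, hy, hyz⟩ := exists_analysis_canonicalDual hVW hF he
  rw [hy]
  have h1 := hyz y hyW
  rw [inner_self_eq_norm_sq_to_K] at h1
  have h2 := norm_inner_le_norm (𝕜 := ℂ) e (Submodule.projection V Wᗮ hVW y - y)
  rw [← h1] at h2
  simp only [Complex.coe_algebraMap, norm_pow, Complex.norm_real, norm_norm] at h2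
  rcases (norm_nonneg (analysis F y)).eq_or_lt with h0 | h0
  · rw [← h0]
    positivity
  · have h4 : ‖analysis F y‖ * ‖analysis F y‖ ≤ M * ‖e‖ * ‖analysis F y‖ := by
      nlinarith [mul_le_mul_of_nonneg_left (h y hyW) (norm_nonneg e)]
    exact le_of_mul_le_mul_right h4 h0

end Aliasing

section Diagonal

variable {κ : Type*} [Fintype κ] {W : Submodule ℂ H}

variable {ι : Type*} [Fintype ι]

theorem norm_analysis_sq_of_eigenbasis (b : OrthonormalBasis κ ℂ W) {F : ι → H} {l : κ → ℝ}
    (h : ∀ i, frameOperator F (b i) = (l i : ℂ) • (b i : H)) {z : H} (hz : z ∈ W) :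
    ‖analysis F z‖ ^ 2 = ∑ i, l i * ‖⟪(b i : H), z⟫_ℂ‖ ^ 2 := by
  classical
  refine norm_sq_eq_sum_of_inner b (analysis F : H →ₗ[ℂ] EuclideanSpace ℂ ι) l (fun i j => ?_) hz
  have hb := orthonormal_iff_ite.mp b.orthonormal i j
  rw [Submodule.coe_inner] at hb
  change ⟪analysis F (b i), analysis F (b j)⟫_ℂ = _
  rw [inner_analysis_analysis, h, inner_smul_left, hb]
  split_ifs <;> simp

end Diagonal

end

section

variable {H : Type*} [NormedAddCommGroup H] [InnerProductSpace ℂ H]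

/-! ### Unitaries preserving `W` -/

section Unitary

variable {W : Submodule ℂ H}

theorem map_eq_of_orthonormalBasis {d : ℕ} (x w : OrthonormalBasis (Fin d) ℂ W)
    {U : H ≃ₗᵢ[ℂ] H} (hU : ∀ j, U (x j : H) = (w (Fin.rev j) : H)) :
    W.map (U : H →ₗ[ℂ] H) = W := by
  have hspan : ∀ b : OrthonormalBasis (Fin d) ℂ W,
      Submodule.span ℂ (Set.range fun j => (b j : H)) = W := by
    intro b
    have h := congrArg (Submodule.map W.subtype) b.toBasis.span_eq
    rw [Submodule.map_span, Submodule.map_subtype_top, ← Set.range_comp] at h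
    simpa [Function.comp_def] using h
  conv_lhs => rw [← hspan x]
  conv_rhs => rw [← hspan w]
  rw [Submodule.map_span, ← Set.range_comp, ← Fin.revPerm.surjective.range_comp]
  congr 2
  funext j
  simpa using hU (Fin.rev j)

/-- A unitary of a subspace extends to a unitary that is the identity on the orthogonal
complement. -/
theorem exists_extend_isometryEquiv [W.HasOrthogonalProjection] (e : W ≃ₗᵢ[ℂ] W) :
    ∃ U : H ≃ₗᵢ[ℂ] H, ∀ f : W, U (f : H) = (e f : H) := by
  let P := W.orthogonalProjectionOnto
  let T : (W ≃ₗᵢ[ℂ] W) → H →ₗ[ℂ] H := fun e =>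
    LinearMap.id - (W.starProjection : H →ₗ[ℂ] H) +
      W.subtype ∘ₗ (e : W →ₗ[ℂ] W) ∘ₗ (P : H →ₗ[ℂ] W)
  have hT : ∀ e f, T e f = (f - W.starProjection f) + (e (P f) : H) := fun e f => rfl
  have hP : ∀ e f, P (T e f) = e (P f) := by
    intro e f
    rw [hT, map_add, Submodule.orthogonalProjectionOnto_mem_subspace_eq_self,
      Submodule.orthogonalProjectionOnto_apply_of_mem_orthogonal
        (W.sub_starProjection_mem_orthogonal f), zero_add]
  have hinv : ∀ e f, T e.symm (T e f) = f := by
    intro e f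
    rw [hT, hP, LinearIsometryEquiv.symm_apply_apply, Submodule.starProjection_apply]
    change T e f - (P (T e f) : H) + _ = f
    rw [hP, hT, add_sub_cancel_right]
    exact sub_add_cancel _ _
  have hnorm : ∀ f, ‖T e f‖ = ‖f‖ := by
    intro f
    have h1 : ‖T e f‖ ^ 2 = ‖f‖ ^ 2 := by
      have ho : ∀ g : W, ‖(f - W.starProjection f) + (g : H)‖ ^ 2 =
          ‖f - W.starProjection f‖ ^ 2 + ‖g‖ ^ 2 := by
        intro g
        have := norm_add_sq_eq_norm_sq_add_norm_sq_of_inner_eq_zero (𝕜 := ℂ)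
          (f - W.starProjection f) (g : H)
          (Submodule.inner_left_of_mem_orthogonal g.2 (W.sub_starProjection_mem_orthogonal f))
        simpa [sq] using this
      have h2 := ho (P f)
      have h3 : (f - W.starProjection f) + (P f : H) = f := sub_add_cancel _ _
      rw [h3] at h2
      rw [hT, ho, h2, e.norm_map]
    exact (sq_eq_sq₀ (norm_nonneg _) (norm_nonneg _)).mp h1
  refine ⟨⟨LinearEquiv.ofLinearMap (T e) (T e.symm) ?_ ?_, hnorm⟩, fun f => ?_⟩
  · ext f
    exact hinv e.symm f
  · ext f
    exact hinv e f
  · change T e f = _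
    rw [hT, Submodule.starProjection_eq_self_iff.mpr f.2, sub_self, zero_add]
    exact congrArg (fun g : W => (e g : H)) (W.orthogonalProjectionOnto_mem_subspace_eq_self f)

end Unitary

variable [CompleteSpace H]

/-- Hence `U` carries an eigenbasis of the frame operator to one of the moved frame, with the same
eigenvalues. -/
theorem frameOperator_map {ι : Type*} [Fintype ι] (F : ι → H) (U : H ≃ₗᵢ[ℂ] H) (f : H) :
    frameOperator (fun i => U (F i)) (U f) = U (frameOperator F f) := by
  have h : analysis (fun i => U (F i)) (U f) = analysis F f := by
    ext i
    rw [analysis_apply, analysis_apply, U.inner_map_map]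
  rw [frameOperator, frameOperator, ContinuousLinearMap.comp_apply,
    ContinuousLinearMap.comp_apply, h, synthesis_apply, synthesis_apply, map_sum]
  simp

/-! ### Principal angles and vectors -/

section Angles

variable {V W : Submodule ℂ H} [FiniteDimensional ℂ V] [FiniteDimensional ℂ W]

theorem principalAngle_monotone : Monotone (principalAngle V W) :=
  fun _ _ hij => Real.antitone_arccos (eigenvalueList_antitone _ hij)

theorem principalAngle_le (j : ℕ) : principalAngle V W j ≤ Real.pi / 2 :=
  Real.arccos_le_pi_div_two.mpr (eigenvalueList_nonneg _ j)

variable {d : ℕ} {w : OrthonormalBasis (Fin d) ℂ W}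

/-- Squaring removes the absolute value: `|P_V P_W|² = P_W P_V P_W`, and `P_W` fixes `w_j`. -/
theorem IsPrincipal.starProjection_apply (hw : IsPrincipal V W w) (j : Fin d) :
    W.starProjection (V.starProjection (w j)) =
      ((Real.cos (principalAngle V W j) ^ 2 : ℝ) : ℂ) • (w j : H) := by
  have h1 := congrArg (fun T : H →L[ℂ] H => T (w j))
    (CFC.abs_mul_abs (V.starProjection * W.starProjection))
  simp only [mul_apply_eq_comp, star_mul, hw j, map_smul, smul_smul,
    (isSelfAdjoint_starProjection V).star_eq, (isSelfAdjoint_starProjection W).star_eq,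
    Submodule.starProjection_eq_self_iff.mpr (w j).2,
    Submodule.starProjection_eq_self_iff.mpr (V.starProjection_apply_mem _)] at h1
  rw [← h1]
  push_cast
  rw [sq]

/-- A zero cosine would give `‖P_V w_j‖² = ⟨w_j, P_W P_V w_j⟩ = 0`. -/
theorem IsPrincipal.cos_pos (hw : IsPrincipal V W w) (hVW : IsCompl V Wᗮ) (j : Fin d) :
    0 < Real.cos (principalAngle V W j) := by
  have h0 : 0 ≤ Real.cos (principalAngle V W j) :=
    Real.cos_nonneg_of_neg_pi_div_two_le_of_le
      ((neg_nonpos.mpr Real.pi_div_two_pos.le).trans (Real.arccos_nonneg _)) (principalAngle_le j)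
  refine h0.lt_of_ne fun h => ?_
  have h1 := hw.starProjection_apply j
  rw [← h] at h1
  have hne : (w j : H) ≠ 0 := fun h2 => w.orthonormal.ne_zero j (Subtype.ext h2)
  apply starProjection_ne_zero hVW (w j).2 hne
  have h2 : ⟪V.starProjection (w j), V.starProjection (w j)⟫_ℂ = 0 := by
    rw [Submodule.inner_starProjection_left_eq_right,
      Submodule.starProjection_eq_self_iff.mpr (V.starProjection_apply_mem _)]
    rw [← Submodule.starProjection_eq_self_iff.mpr (w j).2,
      Submodule.inner_starProjection_left_eq_right,
      Submodule.starProjection_eq_self_iff.mpr (w j).2, h1]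
    simp
  exact inner_self_eq_zero.mp h2

/-- Strictness matters: `Real.tan` takes the default value `0` at `π / 2`, so monotonicity would
fail there. -/
theorem IsPrincipal.principalAngle_lt (hw : IsPrincipal V W w) (hVW : IsCompl V Wᗮ) (j : Fin d) :
    principalAngle V W j < Real.pi / 2 := by
  refine (principalAngle_le _).lt_of_ne fun h => ?_
  have := hw.cos_pos hVW j
  rw [h, Real.cos_pi_div_two] at this
  exact this.false

theorem tan_principalAngle_nonneg (j : ℕ) :
    0 ≤ Real.tan (principalAngle V W j) :=
  Real.tan_nonneg_of_nonneg_of_le_pi_div_two (Real.arccos_nonneg _) (principalAngle_le j)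

theorem IsPrincipal.tan_le_tan (hw : IsPrincipal V W w) (hVW : IsCompl V Wᗮ) {i j : Fin d}
    (hij : i ≤ j) :
    Real.tan (principalAngle V W i) ≤ Real.tan (principalAngle V W j) := by
  have hlow : ∀ k : ℕ, -(Real.pi / 2) < principalAngle V W k := fun k =>
    (neg_lt_zero.mpr Real.pi_div_two_pos).trans_le (Real.arccos_nonneg _)
  exact Real.strictMonoOn_tan.monotoneOn ⟨hlow i, hw.principalAngle_lt hVW i⟩
    ⟨hlow j, hw.principalAngle_lt hVW j⟩ (principalAngle_monotone hij)

theorem IsPrincipal.norm_projection_sub_sq (hw : IsPrincipal V W w) (hVW : IsCompl V Wᗮ)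
    {z : H} (hz : z ∈ W) :
    ‖Submodule.projection V Wᗮ hVW z - z‖ ^ 2 =
      ∑ i : Fin d, Real.tan (principalAngle V W i) ^ 2 * ‖⟪(w i : H), z⟫_ℂ‖ ^ 2 := by
  rw [ObliqueDuality.norm_projection_sub_sq hVW w (fun i => (hw.cos_pos hVW i).ne')
    hw.starProjection_apply hz]
  refine Finset.sum_congr rfl fun i _ => ?_
  congr 1
  have h := (hw.cos_pos hVW i).ne'
  rw [Real.tan_eq_sin_div_cos, div_pow, Real.sin_sq]
  field_simp

end Angles

/-! ### Comparison of the two diagonal forms -/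

section Bounds

variable {W : Submodule ℂ H} {ι : Type*} [Fintype ι]

/-- `l i = ‖T* b_i‖²`, which the lower frame bound makes positive. -/
theorem eigenvalue_pos {κ : Type*} [Fintype κ] {b : OrthonormalBasis κ ℂ W} {F : ι → H}
    (hF : IsFrameFor F W) {l : κ → ℝ}
    (h : ∀ i, frameOperator F (b i) = (l i : ℂ) • (b i : H)) (i : κ) : 0 < l i := by
  have hne : (b i : H) ≠ 0 := fun h2 => b.orthonormal.ne_zero i (Subtype.ext h2)
  have h1 := hF.norm_analysis_pos (b i).2 hne
  have h2 := inner_analysis_analysis F (b i : H) (b i)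
  have h3 : ‖(b i : H)‖ = 1 := b.orthonormal.1 i
  rw [h, inner_smul_left, inner_self_eq_norm_sq_to_K, inner_self_eq_norm_sq_to_K, h3,
    Complex.conj_ofReal] at h2
  have h4 : ‖analysis F (b i)‖ ^ 2 = l i := by
    have : ((‖analysis F (b i)‖ ^ 2 : ℝ) : ℂ) = ((l i : ℝ) : ℂ) := by simpa using h2
    exact_mod_cast this
  rw [← h4]
  positivity

variable {V : Submodule ℂ H} [FiniteDimensional ℂ V] [FiniteDimensional ℂ W]
  {d : ℕ} {w : OrthonormalBasis (Fin d) ℂ W}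

/-- The lower bound for the aliasing of the canonical dual. -/
theorem IsPrincipal.iSup_le_aliasing (hw : IsPrincipal V W w) (hVW : IsCompl V Wᗮ) {F : ι → H}
    (hF : IsFrameFor F W) (x : OrthonormalBasis (Fin d) ℂ W) {l : Fin d → ℝ} (hl : Antitone l)
    (hx : ∀ i, frameOperator F (x i) = (l i : ℂ) • (x i : H)) :
    (⨆ j : Fin d, Real.tan (principalAngle V W j) / √(l (Fin.rev j))) ≤
      aliasing W (canonicalDual hVW F) := by
  refine Real.iSup_le (fun j => ?_) (aliasing_nonneg _ _)
  have hpos : 0 < √(l (Fin.rev j)) := Real.sqrt_pos.mpr (eigenvalue_pos hF hx _)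
  obtain ⟨z, hz, h0, hzw, hzx⟩ := exists_ne_zero_inner_eq_zero w x j
  have hlow : Real.tan (principalAngle V W j) * ‖z‖ ≤
      ‖Submodule.projection V Wᗮ hVW z - z‖ := by
    refine le_of_abs_le (abs_le_of_sq_le_sq ?_ (norm_nonneg _))
    rw [hw.norm_projection_sub_sq hVW hz, mul_pow, ← sum_sq_norm_inner_coe w hz, Finset.mul_sum]
    refine Finset.sum_le_sum fun i _ => ?_
    rcases lt_or_ge i j with hij | hij
    · simp [hzw i hij]
    · have h1 := hw.tan_le_tan hVW hij
      have h2 := tan_principalAngle_nonneg (V := V) (W := W) j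
      gcongr
  have hupp : ‖analysis F z‖ ≤ √(l (Fin.rev j)) * ‖z‖ := by
    refine le_of_abs_le (abs_le_of_sq_le_sq ?_ (by positivity))
    rw [norm_analysis_sq_of_eigenbasis x hx hz, mul_pow, Real.sq_sqrt (eigenvalue_pos hF hx _).le,
      ← sum_sq_norm_inner_coe x hz, Finset.mul_sum]
    refine Finset.sum_le_sum fun i _ => ?_
    rcases lt_or_ge i (Fin.rev j) with hij | hij
    · simp [hzx i hij]
    · have h1 := hl hij
      gcongr
  rw [div_le_iff₀ hpos]
  refine le_of_mul_le_mul_right ?_ (norm_pos_iff.mpr h0)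
  calc _ ≤ _ := hlow
    _ ≤ _ := norm_projection_sub_le_aliasing hVW hF hz
    _ ≤ _ := mul_le_mul_of_nonneg_left hupp (aliasing_nonneg _ _)
    _ = _ := by ring

/-- The upper bound for the aliasing when the principal vectors diagonalize the frame operator. -/
theorem IsPrincipal.aliasing_le_iSup (hw : IsPrincipal V W w) (hVW : IsCompl V Wᗮ) {F : ι → H}
    (hF : IsFrameFor F W) {l : Fin d → ℝ}
    (h : ∀ i, frameOperator F (w i) = (l i : ℂ) • (w i : H)) :
    aliasing W (canonicalDual hVW F) ≤
      ⨆ j : Fin d, Real.tan (principalAngle V W j) / √(l j) := by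
  have hM : 0 ≤ ⨆ j : Fin d, Real.tan (principalAngle V W j) / √(l j) :=
    Real.iSup_nonneg fun j => div_nonneg (tan_principalAngle_nonneg j) (Real.sqrt_nonneg _)
  refine aliasing_canonicalDual_le hVW hF hM fun y hy => ?_
  refine le_of_abs_le (abs_le_of_sq_le_sq ?_ (by positivity))
  rw [hw.norm_projection_sub_sq hVW hy, mul_pow, norm_analysis_sq_of_eigenbasis w h hy,
    Finset.mul_sum]
  refine Finset.sum_le_sum fun j _ => ?_
  have hl := eigenvalue_pos hF h j
  have h1 := le_ciSup (Set.finite_range fun j : Fin d =>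
    Real.tan (principalAngle V W j) / √(l j)).bddAbove j
  rw [div_le_iff₀ (Real.sqrt_pos.mpr hl)] at h1
  have h2 := pow_le_pow_left₀ (tan_principalAngle_nonneg j) h1 2
  rw [mul_pow, Real.sq_sqrt hl.le] at h2
  -- Termwise, `tan² θ_j ≤ M² l_j`, where `M` is the supremum.
  rw [← mul_assoc]
  exact mul_le_mul_of_nonneg_right h2 (by positivity)

end Bounds

end

end

end ObliqueDuality

theorem theorem5p4 {H : Type*} [NormedAddCommGroup H] [InnerProductSpace ℂ H] [CompleteSpace H]
    (V W : Submodule ℂ H) [FiniteDimensional ℂ V] [FiniteDimensional ℂ W]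
    (hVW : IsCompl V Wᗮ) {d n : ℕ}
    -- principal vectors of `W`
    (w : OrthonormalBasis (Fin d) ℂ W) (hw : ObliqueDuality.IsPrincipal V W w)
    (F : Fin n → H) (hF : ObliqueDuality.IsFrameFor F W)
    -- an orthonormal basis of `W` of eigenvectors of the frame operator of `F`
    (x : OrthonormalBasis (Fin d) ℂ W)
    (hx : ∀ j : Fin d, ObliqueDuality.frameOperator F (x j : H) =
      ((ObliqueDuality.eigenvalueList (ObliqueDuality.frameOperator F) j : ℝ) : ℂ) • (x j : H)) :
    -- the lower bound
    (∀ U : H ≃ₗᵢ[ℂ] H, W.map (U : H →ₗ[ℂ] H) = W →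
      (⨆ j : Fin d, Real.tan (ObliqueDuality.principalAngle V W j) /
        √(ObliqueDuality.eigenvalueList (ObliqueDuality.frameOperator F) (Fin.rev j))) ≤
      ObliqueDuality.aliasing W (ObliqueDuality.canonicalDual hVW (fun i => U (F i)))) ∧
    -- equality for every unitary that sends the eigenvectors to the reversed principal vectors
    (∀ U₀ : H ≃ₗᵢ[ℂ] H, (∀ j : Fin d, U₀ (x j : H) = (w (Fin.rev j) : H)) →
      ObliqueDuality.aliasing W (ObliqueDuality.canonicalDual hVW (fun i => U₀ (F i))) =
      ⨆ j : Fin d, Real.tan (ObliqueDuality.principalAngle V W j) /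
        √(ObliqueDuality.eigenvalueList (ObliqueDuality.frameOperator F) (Fin.rev j))) ∧
    -- such unitaries exist and preserve `W`, so that the lower bound is sharp
    (∃ U₀ : H ≃ₗᵢ[ℂ] H, W.map (U₀ : H →ₗ[ℂ] H) = W ∧
      (∀ j : Fin d, U₀ (x j : H) = (w (Fin.rev j) : H)) ∧
      ObliqueDuality.aliasing W (ObliqueDuality.canonicalDual hVW (fun i => U₀ (F i))) =
      ⨆ j : Fin d, Real.tan (ObliqueDuality.principalAngle V W j) /
        √(ObliqueDuality.eigenvalueList (ObliqueDuality.frameOperator F) (Fin.rev j))) := by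
  have hbound : ∀ U : H ≃ₗᵢ[ℂ] H, W.map (U : H →ₗ[ℂ] H) = W →
      (⨆ j : Fin d, Real.tan (ObliqueDuality.principalAngle V W j) /
        √(ObliqueDuality.eigenvalueList (ObliqueDuality.frameOperator F) (Fin.rev j))) ≤
      ObliqueDuality.aliasing W (ObliqueDuality.canonicalDual hVW (fun i => U (F i))) := by
    intro U hU
    refine hw.iSup_le_aliasing hVW (hF.map U hU)
      -- The basis `U x_i`, viewed in `W` through `U(W) = W`.
      (x.map ((U.submoduleMap W).trans (LinearIsometryEquiv.ofEq _ _ hU)))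
      (l := fun j : Fin d => ObliqueDuality.eigenvalueList (ObliqueDuality.frameOperator F) j)
      (fun i j hij => ObliqueDuality.eigenvalueList_antitone _ hij) fun i => ?_
    change ObliqueDuality.frameOperator (fun i => U (F i)) (U (x i)) = _ • U (x i)
    rw [ObliqueDuality.frameOperator_map, hx, map_smul]
  have heq : ∀ U₀ : H ≃ₗᵢ[ℂ] H, (∀ j : Fin d, U₀ (x j : H) = (w (Fin.rev j) : H)) →
      ObliqueDuality.aliasing W (ObliqueDuality.canonicalDual hVW (fun i => U₀ (F i))) =
      ⨆ j : Fin d, Real.tan (ObliqueDuality.principalAngle V W j) /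
        √(ObliqueDuality.eigenvalueList (ObliqueDuality.frameOperator F) (Fin.rev j)) := by
    intro U₀ h
    have hU := ObliqueDuality.map_eq_of_orthonormalBasis x w h
    refine le_antisymm (hw.aliasing_le_iSup hVW (hF.map U₀ hU) (l := fun j : Fin d =>
      ObliqueDuality.eigenvalueList (ObliqueDuality.frameOperator F) (Fin.rev j)) fun i => ?_)
      (hbound U₀ hU)
    -- `w_i = U₀ x_{rev i}` is an eigenvector of the moved frame for `λ_{rev i}`.
    have h1 := h (Fin.rev i)
    rw [Fin.rev_rev] at h1
    rw [← h1, ObliqueDuality.frameOperator_map, hx, map_smul]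
  refine ⟨hbound, heq, ?_⟩
  obtain ⟨U₀, hU₀⟩ := ObliqueDuality.exists_extend_isometryEquiv (x.equiv w Fin.revPerm)
  have h : ∀ j : Fin d, U₀ (x j : H) = (w (Fin.rev j) : H) := by
    intro j
    rw [hU₀, OrthonormalBasis.equiv_apply_basis, Fin.revPerm_apply]
  exact ⟨U₀, ObliqueDuality.map_eq_of_orthonormalBasis x w h, h, heq U₀ h⟩
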